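/- Let $\mathbb{O}$ be the algebra of octonions with its standard basis $e_0=1,e_1,\dots,e_7$, where $e_ie_j=-\delta_{ij}+\sum_{k=1}^7\epsilon_{ijk}e_k$ for $1\le i,j\le 7$ and $\epsilon_{ijk}$ is the totally antisymmetric symbol that equals $1$ on the triples $(1,2,3),(1,4,5),(2,4,6),(3,4,7),(5,3,6),(6,1,7),(7,2,5)$ and vanishes on all triples that are not permutations of these. Fix $p\in\{0,1,\dots,6\}$, put $q=7-p$, and identify $\mathbb{R}^{p+1}$ with the span of $e_0,\dots,e_p$ and $\mathbb{R}^q$ with the span of $e_{p+1},\dots,e_7$. Let $\mathbb{S}$ be the unit sphere of $\mathbb{R}^q$. Every $\boldsymbol{x}\in\mathbb{O}=\mathbb{R}^{p+1}\oplus\mathbb{R}^q$ can be written as $\boldsymbol{x}=\boldsymbol{x}_p+r\underline{\omega}$ with $\boldsymbol{x}_p\in\mathbb{R}^{p+1}$, $r\ge 0$, $\underline{\omega}\in\mathbb{S}$. Write $D_{\boldsymbol{x}_p}=\sum_{i=0}^p e_i\partial_{x_i}$ (acting by multiplication from the left) and $\Delta_{\boldsymbol{x}_p}=\sum_{i=0}^p\partial_{x_i}^2$.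 A function $f:\mathbb{O}\to\mathbb{O}$ is called (left) generalized partial-slice monogenic of type $p$ on $\mathbb{O}$ if, for every $\underline{\omega}\in\mathbb{S}$, the function $(\boldsymbol{x}_p,r)\mapsto f(\boldsymbol{x}_p+r\underline{\omega})$ is of class $C^1$ on $\mathbb{R}^{p+1}\times\mathbb{R}$ and satisfies $(D_{\boldsymbol{x}_p}+\underline{\omega}\,\partial_r)f(\boldsymbol{x}_p+r\underline{\omega})=0$ there. Let $f_0:\mathbb{R}^{p+1}\to\mathbb{O}$ be a polynomial, that is, each of its eight real components is a real polynomial in $x_0,\dots,x_p$. Its generalized partial-slice Cauchy–Kovalevskaya extension $CK[f_0]:\mathbb{O}\to\mathbb{O}$ is defined by $$CK[f_0](\boldsymbol{x}_p+r\underline{\omega})=\sum_{k=0}^{\infty}\frac{r^{2k}}{(2k)!}(-\Delta_{\boldsymbol{x}_p})^k f_0(\boldsymbol{x}_p)+\underline{\omega}\sum_{k=0}^{\infty}\frac{r^{2k+1}}{(2k+1)!}(-\Delta_{\boldsymbol{x}_p})^k\big(D_{\boldsymbol{x}_p}f_0\big)(\boldsymbol{x}_p),$$ where $\boldsymbol{x}_p\in\mathbb{R}^{p+1}$,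 $r\ge 0$, $\underline{\omega}\in\mathbb{S}$; both sums have only finitely many nonzero terms, and the value at $r=0$ does not depend on $\underline{\omega}$. \textbf{Theorem (CK-extension).} For every polynomial $f_0:\mathbb{R}^{p+1}\to\mathbb{O}$, the function $CK[f_0]$ is generalized partial-slice monogenic of type $p$ on $\mathbb{O}$, it satisfies $CK[f_0](\boldsymbol{x}_p)=f_0(\boldsymbol{x}_p)$ for all $\boldsymbol{x}_p\in\mathbb{R}^{p+1}$, and it is the only generalized partial-slice monogenic function of type $p$ on $\mathbb{O}$ whose restriction to $\mathbb{R}^{p+1}$ is $f_0$. -/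

import Mathlib

namespace OctonionCK

noncomputable section

/-! ### The octonions -/

/-- The octonions: the real vector space `ℝ⁸` with its Euclidean norm; the coordinate vector
`(x₀, …, x₇)` is the octonion `x₀ + x₁ e₁ + ⋯ + x₇ e₇`. The product is `instMulOctonion`. -/
abbrev Octonion : Type := EuclideanSpace ℝ (Fin 8)

/-- The oriented triples `(i, j, k)` with `e_i e_j = e_k`, up to cyclic permutation. -/
def octTriples : List (Fin 8 × Fin 8 × Fin 8) :=
  [(1, 2, 3), (1, 4, 5), (2, 4, 6), (3, 4, 7), (5, 3, 6), (6, 1, 7), (7, 2, 5)]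

/-- The totally antisymmetric symbol `ε_{ijk}`: it is the sign of `σ` if `(i, j, k)` is the
permutation `σ` of one of the triples, and `0` otherwise. -/
def octEps (i j k : Fin 8) : ℤ :=
  if (i, j, k) ∈ octTriples ∨ (j, k, i) ∈ octTriples ∨ (k, i, j) ∈ octTriples then 1
  else if (j, i, k) ∈ octTriples ∨ (i, k, j) ∈ octTriples ∨ (k, j, i) ∈ octTriples then -1
  else 0

/-- The coefficient of `e_k` in `e_i e_j`: `e₀` is the unit, and
`e_i e_j = -δ_{ij} + ∑_k ε_{ijk} e_k` for `i, j, k ∈ {1, …, 7}`. -/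
def octConst (i j k : Fin 8) : ℤ :=
  if i = 0 then (if j = k then 1 else 0)
  else if j = 0 then (if i = k then 1 else 0)
  else if k = 0 then (if i = j then -1 else 0)
  else octEps i j k

/-- The bilinear octonion product. -/
instance instMulOctonion : Mul Octonion :=
  ⟨fun x y => WithLp.toLp 2 fun k => ∑ i, ∑ j, (octConst i j k : ℝ) * (x i * y j)⟩

/-- The basis octonions `e₀ = 1, e₁, …, e₇`. -/
def e (i : Fin 8) : Octonion := EuclideanSpace.single i 1

/-! ### The splitting `𝕆 = ℝ^{p+1} ⊕ ℝ^q`, `q = 7 - p`, for `p ∈ {0, …, 6}` -/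

/-- The space `ℝ^{p+1}`. -/
abbrev Base (p : Fin 7) : Type := EuclideanSpace ℝ (Fin ((p : ℕ) + 1))

/-- The inclusion of the indices `0, …, p` into `0, …, 7`. -/
def idx (p : Fin 7) (i : Fin ((p : ℕ) + 1)) : Fin 8 := Fin.castLE (by omega) i

/-- The inclusion `ℝ^{p+1} ⊆ 𝕆`, `(x₀, …, x_p) ↦ ∑_{i ≤ p} x_i e_i`. -/
def emb (p : Fin 7) (x : Base p) : Octonion := ∑ i, x i • e (idx p i)

/-- The component in `ℝ^{p+1}` of an octonion. -/
def basePart (p : Fin 7) (x : Octonion) : Base p := WithLp.toLp 2 fun i => x (idx p i)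

/-- The component in `ℝ^q` of an octonion, `∑_{i > p} x_i e_i`. -/
def restPart (p : Fin 7) (x : Octonion) : Octonion := x - emb p (basePart p x)

/-- The unit sphere `𝕊` of `ℝ^q`, consisting of the unit octonions in the span
of `e_{p+1}, …, e₇`. -/
def sphere (p : Fin 7) : Set Octonion :=
  {ω | (∀ i : Fin 8, (i : ℕ) ≤ (p : ℕ) → ω i = 0) ∧ ‖ω‖ = 1}

/-! ### Generalized partial-slice monogenic functions -/

/-- The parametrization `(x_p, r) ↦ x_p + r ω` of the slice `ℝ^{p+1} ⊕ ω ℝ` by `ℝ^{p+1} × ℝ`. -/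
def slice (p : Fin 7) (ω : Octonion) (y : Base p × ℝ) : Octonion := emb p y.1 + y.2 • ω

/-- The operator `D_ω = ∑_{i ≤ p} e_i ∂_{x_i} + ω ∂_r`, acting from the left on functions of
`(x_p, r)`. -/
def sliceD (p : Fin 7) (ω : Octonion) (F : Base p × ℝ → Octonion) (y : Base p × ℝ) : Octonion :=
  (∑ i, e (idx p i) * fderiv ℝ F y (EuclideanSpace.single i 1, 0)) + ω * fderiv ℝ F y (0, 1)

/-- `f` is (left) generalized partial-slice monogenic of type `p` on the domain `Ω`:
for each `ω ∈ 𝕊` its restriction to `Ω ∩ (ℝ^{p+1} ⊕ ω ℝ)` is of class `C¹` and is annihilated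
by `D_ω`. Only the values of `f` on `Ω` matter. -/
def IsGSM (p : Fin 7) (Ω : Set Octonion) (f : Octonion → Octonion) : Prop :=
  ∀ ω ∈ sphere p,
    ContDiffOn ℝ 1 (f ∘ slice p ω) (slice p ω ⁻¹' Ω) ∧
    ∀ y ∈ slice p ω ⁻¹' Ω, sliceD p ω (f ∘ slice p ω) y = 0

/-! ### The Cauchy–Kovalevskaya extension -/

/-- `f₀ : ℝ^{p+1} → 𝕆` is a polynomial: each of its eight real components is a real polynomial
in `x₀, …, x_p`. -/
def IsPolynomialMap (p : Fin 7) (f₀ : Base p → Octonion) : Prop :=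
  ∀ j : Fin 8, ∃ P : MvPolynomial (Fin ((p : ℕ) + 1)) ℝ,
    ∀ x : Base p, f₀ x j = MvPolynomial.eval (fun i => x i) P

/-- The operator `D_{x_p} = ∑_{i ≤ p} e_i ∂_{x_i}`, acting from the left. -/
def baseD (p : Fin 7) (f : Base p → Octonion) (x : Base p) : Octonion :=
  ∑ i, e (idx p i) * fderiv ℝ f x (EuclideanSpace.single i 1)

/-- The operator `(-Δ)^k`, with `Δ` the Laplacian of `ℝ^{p+1}`. -/
def negLaplacianPow (p : Fin 7) (k : ℕ) (f : Base p → Octonion) : Base p → Octonion :=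
  (fun g : Base p → Octonion => -(Laplacian.laplacian g))^[k] f

/-- The value of the extension series at `x_p + r ω`:
`∑_k r^{2k}/(2k)! (-Δ)^k f₀(x_p) + ω ∑_k r^{2k+1}/(2k+1)! (-Δ)^k (D_{x_p} f₀)(x_p)`. -/
def ckSeries (p : Fin 7) (f₀ : Base p → Octonion) (x : Base p) (r : ℝ) (ω : Octonion) :
    Octonion :=
  (∑' k : ℕ, (r ^ (2 * k) / ((2 * k).factorial : ℝ)) • negLaplacianPow p k f₀ x) +
  ω * ∑' k : ℕ,
    (r ^ (2 * k + 1) / ((2 * k + 1).factorial : ℝ)) • negLaplacianPow p k (baseD p f₀) x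

/-- The generalized partial-slice Cauchy–Kovalevskaya extension `CK[f₀] : 𝕆 → 𝕆`: the series is
evaluated at `r = |x_q|` and `ω = x_q / |x_q|`. When `x_q = 0` the second sum vanishes, so the
choice of `ω` is irrelevant; see `CK_slice`. -/
def CK (p : Fin 7) (f₀ : Base p → Octonion) (x : Octonion) : Octonion :=
  ckSeries p f₀ (basePart p x) ‖restPart p x‖ (‖restPart p x‖⁻¹ • restPart p x)

/-! ### Consistency of the definition of `CK` -/

theorem emb_apply (p : Fin 7) (x : Base p) (i : Fin ((p : ℕ) + 1)) : emb p x (idx p i) = x i := by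
  have h : ∀ j, (idx p i = idx p j) = (i = j) := fun j => by
    simp [idx, Fin.ext_iff]
  simp [emb, e, Pi.single_apply, h]

theorem basePart_slice (p : Fin 7) {ω : Octonion} (hω : ω ∈ sphere p) (y : Base p × ℝ) :
    basePart p (slice p ω y) = y.1 := by
  ext i
  have h : ω (idx p i) = 0 := hω.1 _ (by simp [idx]; omega)
  simp [basePart, slice, emb_apply, h]

theorem restPart_slice (p : Fin 7) {ω : Octonion} (hω : ω ∈ sphere p) (y : Base p × ℝ) :
    restPart p (slice p ω y) = y.2 • ω := by
  rw [restPart, basePart_slice p hω]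
  simp [slice]

theorem mul_zero_oct (x : Octonion) : x * (0 : Octonion) = 0 := by
  ext k
  change ∑ i, ∑ j, (octConst i j k : ℝ) * (x i * (0 : Octonion) j) = 0
  simp

/-- `CK[f₀]` takes the prescribed value at `x_p + r ω` for all `r ≥ 0` and all `ω ∈ 𝕊`. -/
theorem CK_slice (p : Fin 7) (f₀ : Base p → Octonion) {ω : Octonion} (hω : ω ∈ sphere p)
    (x : Base p) {r : ℝ} (hr : 0 ≤ r) :
    CK p f₀ (slice p ω (x, r)) = ckSeries p f₀ x r ω := by
  have hn : ‖r • ω‖ = r := by rw [norm_smul, hω.2, mul_one, Real.norm_of_nonneg hr]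
  rw [CK, basePart_slice p hω, restPart_slice p hω]
  simp only [hn]
  rcases hr.eq_or_lt with h | h
  · subst h
    simp [ckSeries, mul_zero_oct]
  · rw [smul_smul, inv_mul_cancel₀ h.ne', one_smul]

end

end OctonionCK

namespace OctonionCK

noncomputable section

/-! ### Octonion algebra -/

/-! The octonions are not associative, but conj(a)(ax) = ‖a‖²x (`conj_mul_mul_self`), and its
polarisation gives Clifford-type relations between left multiplications. These replace associativity
throughout.

Existence. Write D for `baseD` and D̄ for the operator with conjugate coefficients. The relations
give D̄D = DD̄ = Δ, ω(ωx) = -x and e_i(ωx) = ω(conj(e_i)x) for i ≤ p. For a polynomial the series is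
a finite sum, and applying D_ω to its k-th term leaves a difference of consecutive quantities that
telescopes to zero (`isGSM_CK`).

Uniqueness. On a slice, let F be the difference of two solutions. It vanishes at r = 0, so the
equation forces its whole derivative to vanish there. Replacing F by 0 for r < 0 therefore gives a
C¹ solution on the whole space that vanishes on a half-space (`slice_eq_zero_of_initial`), and
unique continuation finishes.

Unique continuation (`eq_zero_of_dirac`) needs no regularity beyond C¹. Integration by parts gives a
recursion for the moments of u against (ρ - ‖y - c‖²)₊^k, by which a nonzero moment sequence grows
with ratio tending to ρ. If u vanishes on a ball around c, the moments are bounded by a constant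
times a power of a smaller number, so all of them are zero. Differentiating in the centre c shows
that linear functions, hence polynomials, times u also have zero moments. Stone–Weierstrass then
gives u = 0. -/

theorem mul_apply (x y : Octonion) (k : Fin 8) :
    (x * y) k = ∑ i, ∑ j, (octConst i j k : ℝ) * (x i * y j) := rfl

/-- Left multiplication in the octonions as a continuous bilinear map. -/
def mulL : Octonion →ₗ[ℝ] Octonion →L[ℝ] Octonion :=
  LinearMap.toContinuousLinearMap.toLinearMap ∘ₗ LinearMap.mk₂ ℝ (fun x y : Octonion => x * y)
    (fun x y z => by
      ext k; simp only [mul_apply, PiLp.add_apply, add_mul, mul_add, Finset.sum_add_distrib])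
    (fun a x y => by
      ext k
      simp only [mul_apply, PiLp.smul_apply, smul_eq_mul, Finset.mul_sum]
      exact Finset.sum_congr rfl fun i _ => Finset.sum_congr rfl fun j _ => by ring)
    (fun x y z => by
      ext k; simp only [mul_apply, PiLp.add_apply, mul_add, Finset.sum_add_distrib])
    (fun a x y => by
      ext k
      simp only [mul_apply, PiLp.smul_apply, smul_eq_mul, Finset.mul_sum]
      exact Finset.sum_congr rfl fun i _ => Finset.sum_congr rfl fun j _ => by ring)

@[simp] theorem mulL_apply (x y : Octonion) : mulL x y = x * y := rfl

/-- Octonion conjugation. -/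
def conj : Octonion →ₗ[ℝ] Octonion where
  toFun x := WithLp.toLp 2 fun i => if i = 0 then x i else -x i
  map_add' x y := by
    ext i
    by_cases h : i = 0 <;> simp [h]
    ring
  map_smul' a x := by
    ext i
    by_cases h : i = 0 <;> simp [h]

theorem conj_apply (x : Octonion) (i : Fin 8) : conj x i = if i = 0 then x i else -x i := rfl

@[simp] theorem conj_conj (x : Octonion) : conj (conj x) = x := by
  ext i
  by_cases h : i = 0 <;> simp [conj_apply, h]

@[simp] theorem norm_conj (x : Octonion) : ‖conj x‖ = ‖x‖ := by
  rw [EuclideanSpace.norm_eq, EuclideanSpace.norm_eq]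
  congr 1
  refine Finset.sum_congr rfl fun i _ => ?_
  by_cases h : i = 0 <;> simp [conj_apply, h]

/-- The sign of the conjugate of the basis octonion `e i`. -/
def conjSign (i : Fin 8) : ℤ := if i = 0 then 1 else -1

/-- The polarised identity conj(a)(bx) + conj(b)(ax) = 2⟨a,b⟩x on basis elements, a finite check.
Only here do the values of the multiplication table matter; elsewhere only bilinearity is used. -/
theorem octConst_clifford : ∀ i j l k : Fin 8,
    ∑ m, (conjSign i * octConst j l m * octConst i m k
      + conjSign j * octConst i l m * octConst j m k)
      = if i = j ∧ l = k then 2 else 0 := by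
  decide +kernel

theorem conj_mul_mul_self (a x : Octonion) : conj a * (a * x) = ‖a‖ ^ 2 • x := by
  ext k
  have hc (i : Fin 8) : conj a i = (conjSign i : ℝ) * a i := by
    by_cases h : i = 0 <;> simp [conj_apply, conjSign, h]
  have h1 : (conj a * (a * x)) k = ∑ i, ∑ j, ∑ l, a i * a j * x l *
      ((∑ m, conjSign i * octConst j l m * octConst i m k : ℤ) : ℝ) := by
    simp only [mul_apply, hc]
    refine Finset.sum_congr rfl fun i _ => ?_
    simp only [Finset.mul_sum, Int.cast_sum]
    rw [Finset.sum_comm]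
    refine Finset.sum_congr rfl fun j _ => ?_
    rw [Finset.sum_comm]
    refine Finset.sum_congr rfl fun l _ => Finset.sum_congr rfl fun m _ => ?_
    push_cast
    ring
  -- Exchanging i and j allows averaging with `h1`: the identity for the table concerns only
  -- coefficients symmetrised in i and j.
  have h2 : (conj a * (a * x)) k = ∑ i, ∑ j, ∑ l, a i * a j * x l *
      ((∑ m, conjSign j * octConst i l m * octConst j m k : ℤ) : ℝ) := by
    rw [h1, Finset.sum_comm]
    refine Finset.sum_congr rfl fun i _ => Finset.sum_congr rfl fun j _ =>
      Finset.sum_congr rfl fun l _ => by ring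
  have h3 : 2 * (conj a * (a * x)) k = 2 * (‖a‖ ^ 2 * x k) := by
    rw [two_mul]
    nth_rewrite 1 [h1]
    rw [h2, EuclideanSpace.norm_sq_eq]
    simp only [← Finset.sum_add_distrib, ← mul_add, ← Int.cast_add, octConst_clifford]
    simp only [ite_and, Int.cast_ite, Int.cast_ofNat, Int.cast_zero, mul_ite, mul_zero,
      Finset.sum_ite_irrel, Finset.sum_const_zero, Finset.sum_ite_eq, Finset.sum_ite_eq',
      Finset.mem_univ, if_true, Real.norm_eq_abs, sq_abs, Finset.sum_mul, Finset.mul_sum]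
    exact Finset.sum_congr rfl fun i _ => by ring
  simpa using h3

theorem add_mul_oct (a b x : Octonion) : (a + b) * x = a * x + b * x := by
  exact congrArg (fun L => L x) (mulL.map_add a b)

theorem mul_add_oct (a x y : Octonion) : a * (x + y) = a * x + a * y := (mulL a).map_add x y

theorem conj_mul_mul_add (a b x : Octonion) :
    conj a * (b * x) + conj b * (a * x) = (2 * inner ℝ a b) • x := by
  have h := conj_mul_mul_self (a + b) x
  rw [map_add, add_mul_oct, add_mul_oct, mul_add_oct, mul_add_oct, conj_mul_mul_self,
    conj_mul_mul_self, norm_add_sq_real, add_smul, add_smul] at h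
  linear_combination (norm := module) h

theorem neg_mul_oct (a x : Octonion) : (-a) * x = -(a * x) := by
  exact congrArg (fun L => L x) (mulL.map_neg a)

theorem mul_neg_oct (a x : Octonion) : a * (-x) = -(a * x) := (mulL a).map_neg x

section RadialMoments

/-! ### Truncated powers -/

open MeasureTheory Filter Topology Set

/-- With exponent at least 2 the derivative is continuous across the kink at 0, so the derivative
there is the limit of the nearby ones. -/
theorem hasDerivAt_max_zero_pow (k : ℕ) (t : ℝ) :
    HasDerivAt (fun t : ℝ => max t 0 ^ (k + 2)) ((k + 2) * max t 0 ^ (k + 1)) t := by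
  refine hasDerivAt_of_hasDerivAt_of_ne' (x := 0) (g := fun t => (k + 2) * max t 0 ^ (k + 1))
    (fun y hy => ?_) (by fun_prop) (by fun_prop) t
  rcases lt_or_gt_of_ne hy with h | h
  · have : (fun t : ℝ => max t 0 ^ (k + 2)) =ᶠ[𝓝 y] fun _ => 0 := by
      filter_upwards [gt_mem_nhds h] with z hz
      simp [max_eq_right hz.le]
    simpa [max_eq_right h.le] using (hasDerivAt_const y (0 : ℝ)).congr_of_eventuallyEq this
  · have : (fun t : ℝ => max t 0 ^ (k + 2)) =ᶠ[𝓝 y] fun t => t ^ (k + 2) := by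
      filter_upwards [lt_mem_nhds h] with z hz
      simp [max_eq_left hz.le]
    simpa [max_eq_left h.le] using (hasDerivAt_pow (k + 2) y).congr_of_eventuallyEq this

variable {E : Type*} [NormedAddCommGroup E]

/-- The radial truncated power `max (ρ - ‖y‖²) 0 ^ k`. -/
def radialPow (ρ : ℝ) (k : ℕ) (y : E) : ℝ := max (ρ - ‖y‖ ^ 2) 0 ^ k

theorem continuous_radialPow (ρ : ℝ) (k : ℕ) : Continuous (radialPow ρ k : E → ℝ) := by
  unfold radialPow; fun_prop

theorem radialPow_nonneg (ρ : ℝ) (k : ℕ) (y : E) : 0 ≤ radialPow ρ k y :=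
  pow_nonneg (le_max_right _ _) _

theorem radialPow_neg (ρ : ℝ) (k : ℕ) (y : E) : radialPow ρ k (-y) = radialPow ρ k y := by
  simp [radialPow]

theorem radialPow_eq_zero {ρ : ℝ} {k : ℕ} {y : E} (h : ρ ≤ ‖y‖ ^ 2) :
    radialPow ρ (k + 1) y = 0 := by
  simp [radialPow, max_eq_right (sub_nonpos.2 h)]

theorem radialPow_pos {ρ : ℝ} {k : ℕ} {y : E} (h : ‖y‖ ^ 2 < ρ) : 0 < radialPow ρ k y :=
  pow_pos (lt_max_of_lt_left (sub_pos.2 h)) _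

/-- Substituting ‖y‖² = ρ - (ρ - ‖y‖²) on the support turns the factor ‖y‖² into a shift of
exponent, which closes the moment recursion. -/
theorem radialPow_mul_norm_sq (ρ : ℝ) (k : ℕ) (y : E) :
    radialPow ρ (k + 1) y * ‖y‖ ^ 2 = ρ * radialPow ρ (k + 1) y - radialPow ρ (k + 2) y := by
  rcases le_total ρ (‖y‖ ^ 2) with h | h
  · rw [radialPow_eq_zero h, radialPow_eq_zero (k := k + 1) h]; ring
  · simp only [radialPow, max_eq_left (sub_nonneg.2 h)]; ring

variable [InnerProductSpace ℝ E]

theorem hasFDerivAt_radialPow (ρ : ℝ) (k : ℕ) (y : E) :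
    HasFDerivAt (radialPow ρ (k + 2) : E → ℝ)
      (-(2 * (k + 2) * radialPow ρ (k + 1) y) • innerSL ℝ y) y := by
  have h := (hasDerivAt_max_zero_pow k (ρ - ‖y‖ ^ 2)).comp_hasFDerivAt y
    ((hasStrictFDerivAt_norm_sq y).hasFDerivAt.const_sub ρ)
  convert! h using 1
  ext v
  simp [radialPow]
  ring

theorem contDiff_radialPow (ρ : ℝ) (k : ℕ) : ContDiff ℝ 1 (radialPow ρ (k + 2) : E → ℝ) := by
  rw [contDiff_one_iff_fderiv]
  refine ⟨fun y => (hasFDerivAt_radialPow ρ k y).differentiableAt, ?_⟩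
  rw [show fderiv ℝ (radialPow ρ (k + 2) : E → ℝ) = _ from
    funext fun y => (hasFDerivAt_radialPow ρ k y).fderiv]
  have := continuous_radialPow (E := E) ρ (k + 1)
  fun_prop

variable [FiniteDimensional ℝ E]

theorem hasCompactSupport_radialPow (ρ : ℝ) (k : ℕ) (c : E) :
    HasCompactSupport fun y => radialPow ρ (k + 1) (y - c) := by
  refine HasCompactSupport.intro (isCompact_closedBall c (Real.sqrt ρ)) fun y hy => ?_
  rw [Metric.mem_closedBall, dist_eq_norm, not_le] at hy
  exact radialPow_eq_zero ((Real.sqrt_le_left (norm_nonneg _)).1 hy.le)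

variable [MeasurableSpace E] [BorelSpace E]
variable {V : Type*} [NormedAddCommGroup V] [NormedSpace ℝ V]

theorem integrable_radialPow_smul (ρ : ℝ) (k : ℕ) (c : E) {f : E → V} (hf : Continuous f) :
    Integrable fun y => radialPow ρ (k + 1) (y - c) • f y :=
  Continuous.integrable_of_hasCompactSupport
    (((continuous_radialPow ρ _).comp (continuous_id.sub continuous_const)).smul hf)
    (hasCompactSupport_radialPow ρ k c).smul_right

/-! ### Radial moments of solutions of a Dirac-type equation -/

/-- Integration by parts without boundary term, the weight having compact support. The two terms
come from differentiating the truncated power and the linear factor. -/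
theorem integral_radialPow_mul_fderiv (ρ : ℝ) (k : ℕ) (c v w : E) {u : E → V}
    (hu : ContDiff ℝ 1 u) :
    ∫ y, (radialPow ρ (k + 2) (y - c) * inner ℝ v (y - c)) • fderiv ℝ u y w =
      (2 * (k + 2) : ℝ) •
        (∫ y, radialPow ρ (k + 1) (y - c) • ((inner ℝ (y - c) w * inner ℝ v (y - c)) • u y)) -
      inner ℝ v w • ∫ y, radialPow ρ (k + 2) (y - c) • u y := by
  have hd (y : E) : HasFDerivAt (fun y => radialPow ρ (k + 2) (y - c) * inner ℝ v (y - c))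
      (radialPow ρ (k + 2) (y - c) • innerSL ℝ v + inner ℝ v (y - c) •
        (-(2 * (k + 2) * radialPow ρ (k + 1) (y - c)) • innerSL ℝ (y - c))) y := by
    have h1 := (hasFDerivAt_radialPow ρ k (y - c)).comp y ((hasFDerivAt_id y).sub_const c)
    have h2 := (innerSL ℝ v).hasFDerivAt.comp y ((hasFDerivAt_id y).sub_const c)
    exact h1.mul h2
  have hf : ∀ y, fderiv ℝ (fun y => radialPow ρ (k + 2) (y - c) * inner ℝ v (y - c)) y w • u y =
      inner ℝ v w • (radialPow ρ (k + 2) (y - c) • u y) - (2 * (k + 2) : ℝ) •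
        (radialPow ρ (k + 1) (y - c) • ((inner ℝ (y - c) w * inner ℝ v (y - c)) • u y)) := by
    intro y
    rw [(hd y).fderiv]
    simp only [_root_.add_apply, _root_.smul_apply, innerSL_apply_apply,
      smul_eq_mul]
    module
  have huc : Continuous u := hu.continuous
  have i1 : Integrable fun y => inner ℝ v w • (radialPow ρ (k + 2) (y - c) • u y) :=
    (integrable_radialPow_smul ρ (k + 1) c huc).smul _
  have i2 : Integrable fun y => (2 * (k + 2) : ℝ) •
        (radialPow ρ (k + 1) (y - c) • ((inner ℝ (y - c) w * inner ℝ v (y - c)) • u y)) :=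
    (integrable_radialPow_smul ρ k c (by fun_prop)).smul _
  have hdu : Continuous fun y => fderiv ℝ u y w :=
    (hu.continuous_fderiv one_ne_zero).clm_apply continuous_const
  rw [integral_smul_fderiv_eq_neg_fderiv_smul_of_integrable]
  · simp_rw [hf]
    rw [integral_sub i1 i2, integral_smul, integral_smul, neg_sub]
  · simp_rw [hf]
    exact i1.sub i2
  · simp_rw [mul_smul]
    exact integrable_radialPow_smul ρ (k + 1) c (by fun_prop)
  · simp_rw [mul_smul]
    exact integrable_radialPow_smul ρ (k + 1) c (by fun_prop)
  · exact fun y _ => (hd y).differentiableAt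
  · exact fun y _ => hu.differentiable one_ne_zero y

/-- The recursion in `k` for the radial moments of a solution `u` of `∑ A(bᵢ) ∂ᵢ u = 0`. -/
theorem radial_moment_recursion {ι : Type*} [Fintype ι] (b : OrthonormalBasis ι ℝ E)
    [FiniteDimensional ℝ V] (A A' : E →ₗ[ℝ] V →L[ℝ] V) (hA : ∀ v x, A' v (A v x) = ‖v‖ ^ 2 • x)
    {u : E → V} (hu : ContDiff ℝ 1 u) (hAu : ∀ y, ∑ i, A (b i) (fderiv ℝ u y (b i)) = 0)
    (ρ : ℝ) (k : ℕ) (c : E) :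
    (Fintype.card ι + 2 * (k + 2) : ℝ) • ∫ y, radialPow ρ (k + 2) (y - c) • u y =
      (2 * (k + 2) * ρ : ℝ) • ∫ y, radialPow ρ (k + 1) (y - c) • u y := by
  have huc : Continuous u := hu.continuous
  have hdu (w : E) : Continuous fun y => fderiv ℝ u y w :=
    (hu.continuous_fderiv one_ne_zero).clm_apply continuous_const
  let T (j i : ι) : V →L[ℝ] V := (A' (b j)).comp (A (b i))
  have hexp (y : E) : ∑ j, inner ℝ (b j) y • A' (b j) = A' y := by
    conv_rhs => rw [← b.sum_repr' y, map_sum]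
    simp
  have hexp' (y : E) : ∑ j, inner ℝ y (b j) • A (b j) = A y := by
    conv_rhs => rw [← b.sum_repr' y, map_sum]
    simp [real_inner_comm]
  have i1 (j i : ι) : Integrable fun y =>
      (radialPow ρ (k + 2) (y - c) * inner ℝ (b j) (y - c)) • fderiv ℝ u y (b i) := by
    simp_rw [mul_smul]
    have := hdu (b i)
    exact integrable_radialPow_smul ρ (k + 1) c (by fun_prop)
  have i2 (j i : ι) : Integrable fun y => radialPow ρ (k + 1) (y - c) •
      ((inner ℝ (y - c) (b i) * inner ℝ (b j) (y - c)) • u y) :=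
    integrable_radialPow_smul ρ k c (by fun_prop)
  -- The equation is tested against the weight times A'(y - c), with A'(y - c) expanded in the
  -- basis.
  have h0 : ∑ j, ∑ i, T j i (∫ y,
      (radialPow ρ (k + 2) (y - c) * inner ℝ (b j) (y - c)) • fderiv ℝ u y (b i)) = 0 := by
    simp_rw [← fun j i => (T j i).integral_comp_comm (i1 j i)]
    refine Finset.sum_eq_zero fun j _ => ?_
    rw [← integral_finsetSum _ fun i _ => (T j i).integrable_comp (i1 j i)]
    refine (integral_congr_ae (ae_of_all _ fun y => ?_)).trans (integral_zero _ _)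
    simp only [map_smul, T, ContinuousLinearMap.comp_apply]
    rw [← Finset.smul_sum, ← map_sum, hAu, map_zero, smul_zero]
  -- Resumming both expansions gives A'(y - c)A(y - c) = ‖y - c‖².
  have h1 : ∑ j, ∑ i, T j i (∫ y, radialPow ρ (k + 1) (y - c) •
      ((inner ℝ (y - c) (b i) * inner ℝ (b j) (y - c)) • u y)) =
      ∫ y, radialPow ρ (k + 1) (y - c) • (‖y - c‖ ^ 2 • u y) := by
    simp_rw [← fun j i => (T j i).integral_comp_comm (i2 j i)]
    simp_rw [← fun j => integral_finsetSum Finset.univ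
      fun i _ => (T j i).integrable_comp (i2 j i)]
    rw [← integral_finsetSum _ fun j _ => integrable_finsetSum _
      fun i _ => (T j i).integrable_comp (i2 j i)]
    refine integral_congr_ae (ae_of_all _ fun y => ?_)
    simp only [← hA]
    rw [← hexp' (y - c), ← hexp (y - c)]
    simp only [map_smul, T, ContinuousLinearMap.comp_apply, _root_.sum_apply,
      _root_.smul_apply, map_sum, Finset.smul_sum, mul_smul]
    exact Finset.sum_comm
  -- Only i = j contributes, each time A'(b_j)A(b_j) = 1, so the dimension appears.
  have h2 (x : V) : ∑ j, ∑ i, T j i (inner ℝ (b j) (b i) • x) = (Fintype.card ι : ℝ) • x := by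
    classical
    simp [b.inner_eq_ite, T, hA, ite_smul, apply_ite, ← Nat.cast_smul_eq_nsmul ℝ]
  simp_rw [integral_radialPow_mul_fderiv ρ k c _ _ hu, map_sub, Finset.sum_sub_distrib, h2,
    map_smul, ← Finset.smul_sum] at h0
  have h3 : ∫ y, radialPow ρ (k + 1) (y - c) • (‖y - c‖ ^ 2 • u y) =
      ρ • (∫ y, radialPow ρ (k + 1) (y - c) • u y) - ∫ y, radialPow ρ (k + 2) (y - c) • u y := by
    rw [← integral_smul, ← integral_sub ((integrable_radialPow_smul ρ k c huc).fun_smul ρ)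
      (integrable_radialPow_smul ρ (k + 1) c huc)]
    refine integral_congr_ae (ae_of_all _ fun y => ?_)
    simp only [smul_smul, radialPow_mul_norm_sq, sub_smul]
  rw [h1, h3] at h0
  rw [sub_eq_zero] at h0
  rw [add_smul, ← h0]
  module

end RadialMoments

section UniqueContinuation

/-! ### Unique continuation -/

open MeasureTheory Filter Topology Set

variable {E : Type*} [NormedAddCommGroup E] [InnerProductSpace ℝ E] [FiniteDimensional ℝ E]
  [MeasurableSpace E] [BorelSpace E]
  {V : Type*} [NormedAddCommGroup V] [NormedSpace ℝ V]

/-- Where u does not vanish, ‖y - c‖² ≥ δ, so each of the k extra factors of the weight is at most ρ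
- δ. -/
theorem norm_integral_radialPow_smul_le (ρ δ : ℝ) (hδ : δ ≤ ρ) (c : E) {u : E → V}
    (hu : Continuous u) (h0 : ∀ y, ‖y - c‖ ^ 2 < δ → u y = 0) (k : ℕ) :
    ‖∫ y, radialPow ρ (k + 1) (y - c) • u y‖ ≤
      (ρ - δ) ^ k * ∫ y, radialPow ρ 1 (y - c) * ‖u y‖ := by
  rw [← integral_const_mul]
  refine norm_integral_le_of_norm_le
    ((integrable_radialPow_smul ρ 0 c hu.norm).const_mul _) (ae_of_all _ fun y => ?_)
  rw [norm_smul, Real.norm_of_nonneg (radialPow_nonneg _ _ _), ← mul_assoc]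
  rcases lt_or_ge (‖y - c‖ ^ 2) δ with h | h
  · simp [h0 y h]
  · refine mul_le_mul_of_nonneg_right ?_ (norm_nonneg _)
    rw [radialPow, radialPow, pow_succ, pow_one]
    refine mul_le_mul_of_nonneg_right ?_ (le_max_right _ _)
    exact pow_le_pow_left₀ (le_max_right _ _)
      (max_le (sub_le_sub_left h _) (sub_nonneg.2 hδ)) _

/-- The radial moments of a solution of `∑ A(bᵢ) ∂ᵢ u = 0` vanish around every point near which
`u` vanishes. -/
theorem radial_moment_eq_zero {ι : Type*} [Fintype ι] (b : OrthonormalBasis ι ℝ E)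
    [FiniteDimensional ℝ V] (A A' : E →ₗ[ℝ] V →L[ℝ] V) (hA : ∀ v x, A' v (A v x) = ‖v‖ ^ 2 • x)
    {u : E → V} (hu : ContDiff ℝ 1 u) (hAu : ∀ y, ∑ i, A (b i) (fderiv ℝ u y (b i)) = 0)
    {c : E} (hc : ∀ᶠ y in 𝓝 c, u y = 0) (ρ : ℝ) (k : ℕ) :
    ∫ y, radialPow ρ (k + 1) (y - c) • u y = 0 := by
  obtain ⟨ε, hε, hε0⟩ := Metric.eventually_nhds_iff.1 hc
  have h0 (y : E) (hy : ‖y - c‖ ^ 2 < ε ^ 2) : u y = 0 :=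
    hε0 (by rw [dist_eq_norm]; exact lt_of_pow_lt_pow_left₀ 2 hε.le hy)
  have hδ : 0 < ε ^ 2 := by positivity
  set δ := ε ^ 2
  rcases le_or_gt ρ δ with hρ | hρ
  · refine (integral_congr_ae (ae_of_all _ fun y => ?_)).trans (integral_zero _ _)
    rcases lt_or_ge (‖y - c‖ ^ 2) ρ with h | h
    · simp [h0 y (h.trans_le hρ)]
    · simp [radialPow_eq_zero h]
  have hρ0 : 0 < ρ := hδ.trans hρ
  -- Any q strictly between ρ - δ and ρ would do: the bound makes M k / q^k summable, whereas the
  -- recursion makes its ratios tend to ρ/q > 1.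
  set q := ρ - δ / 2 with hq
  have hq0 : 0 < q := by linarith
  set M : ℕ → V := fun k => ∫ y, radialPow ρ (k + 1) (y - c) • u y with hM
  have hpos (k : ℕ) : (0 : ℝ) < Fintype.card ι + 2 * (k + 2) := by positivity
  have hrec (k : ℕ) : M (k + 1) = (2 * (k + 2) * ρ / (Fintype.card ι + 2 * (k + 2)) : ℝ) • M k := by
    have h := radial_moment_recursion b A A' hA hu hAu ρ k c
    rw [div_eq_inv_mul, mul_smul, ← h, smul_smul, inv_mul_cancel₀ (hpos k).ne', one_smul]
  have hM0 : M 0 = 0 := by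
    by_contra hne
    have hMne (k : ℕ) : M k ≠ 0 := by
      induction k with
      | zero => exact hne
      | succ k ih =>
        rw [hrec]
        have := hpos k
        exact smul_ne_zero (by positivity) ih
    have hsum : Summable fun k => (q ^ k)⁻¹ • M k := by
      refine Summable.of_norm_bounded
        (g := fun k => ((ρ - δ) / q) ^ k * ∫ y, radialPow ρ 1 (y - c) * ‖u y‖)
        ((summable_geometric_of_lt_one (div_nonneg (by linarith) hq0.le)
          ((div_lt_one hq0).2 (by linarith))).mul_right _) fun k => ?_
      rw [norm_smul, norm_inv, norm_pow, Real.norm_of_nonneg hq0.le, div_pow, div_eq_inv_mul,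
        mul_assoc]
      exact mul_le_mul_of_nonneg_left
        (norm_integral_radialPow_smul_le ρ δ hρ.le c hu.continuous h0 k) (by positivity)
    refine not_summable_of_ratio_test_tendsto_gt_one (l := 1 * (ρ / q)) ?_ ?_ hsum
    · rw [one_mul, one_lt_div hq0]; linarith
    -- The recursion factor is ρ (k + 2) / (k + 2 + card ι / 2), which tends to ρ.
    · have ht := ((tendsto_natCast_div_add_atTop (Fintype.card ι / 2 : ℝ)).comp
        (tendsto_add_atTop_nat 2)).mul_const (ρ / q)
      refine ht.congr fun k => ?_
      have h1 : ‖M k‖ ≠ 0 := norm_ne_zero_iff.2 (hMne k)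
      have h2 := hpos k
      rw [hrec, norm_smul, norm_smul, norm_smul, norm_inv, norm_inv, norm_pow, norm_pow,
        Real.norm_of_nonneg hq0.le, Real.norm_of_nonneg (by positivity)]
      simp only [Function.comp_apply, Nat.cast_add, Nat.cast_ofNat]
      have h3 : (k + 2 + Fintype.card ι / 2 : ℝ) ≠ 0 := by positivity
      field_simp
      ring
  change M k = 0
  induction k with
  | zero => exact hM0
  | succ k ih => rw [hrec, ih, smul_zero]

/-- All radial moments of `f` around points of `U` vanish. -/
def RadiallyNull (U : Set E) (f : E → ℝ) : Prop :=
  ∀ c ∈ U, ∀ (ρ : ℝ) (k : ℕ), ∫ y, radialPow ρ (k + 1) (y - c) * f y = 0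

/-- As a function of the centre, a moment is a convolution that vanishes on the open set U, so its
derivative vanishes too. Differentiating the weight of exponent k + 2 in direction v yields exponent
k + 1 times ⟨v, y - c⟩, and the part with ⟨v, c⟩ is already null. -/
theorem RadiallyNull.inner_mul {U : Set E} (hU : IsOpen U) {f : E → ℝ} (hf : Continuous f)
    (h : RadiallyNull U f) (v : E) : RadiallyNull U fun y => inner ℝ v y * f y := by
  intro c hc ρ k
  have hcs : HasCompactSupport (radialPow ρ (k + 2) : E → ℝ) := by
    simpa using hasCompactSupport_radialPow ρ (k + 1) (0 : E)
  have hd := hcs.hasFDerivAt_convolution_right (ContinuousLinearMap.mul ℝ ℝ)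
    (μ := volume) (f := f) hf.locallyIntegrable (contDiff_radialPow ρ k) c
  have hz : (convolution f (radialPow ρ (k + 2)) (ContinuousLinearMap.mul ℝ ℝ) volume)
      =ᶠ[𝓝 c] fun _ => (0 : ℝ) := by
    filter_upwards [hU.mem_nhds hc] with c' hc'
    rw [← h c' hc' ρ (k + 1)]
    refine integral_congr_ae (ae_of_all _ fun y => ?_)
    simp only [ContinuousLinearMap.mul_apply']
    rw [← radialPow_neg, neg_sub, mul_comm]
  have h0 := congrArg (fun L => L v)
    (hd.unique ((hasFDerivAt_const (0 : ℝ) c).congr_of_eventuallyEq hz))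
  simp only [_root_.zero_apply] at h0
  rw [convolution_precompR_apply _ hf.locallyIntegrable (hcs.fderiv ℝ)
    ((contDiff_radialPow ρ k).continuous_fderiv one_ne_zero)] at h0
  have i1 : Integrable fun y => radialPow ρ (k + 1) (y - c) * (inner ℝ v y * f y) :=
    integrable_radialPow_smul ρ k c (by fun_prop)
  have i2 : Integrable fun y => inner ℝ v c * (radialPow ρ (k + 1) (y - c) * f y) :=
    (integrable_radialPow_smul ρ k c hf).const_mul _
  have h1 : (2 * (k + 2) : ℝ) * ((∫ y, radialPow ρ (k + 1) (y - c) * (inner ℝ v y * f y)) -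
      ∫ y, inner ℝ v c * (radialPow ρ (k + 1) (y - c) * f y)) = 0 := by
    rw [← integral_sub i1 i2, ← integral_const_mul]
    refine Eq.trans (integral_congr_ae (ae_of_all _ fun y => ?_)) h0
    simp only [ContinuousLinearMap.mul_apply', (hasFDerivAt_radialPow ρ k _).fderiv,
      _root_.smul_apply, innerSL_apply_apply, smul_eq_mul]
    rw [← radialPow_neg _ _ (c - y), neg_sub, inner_sub_left, real_inner_comm v c,
      real_inner_comm v y]
    ring
  rw [integral_const_mul, h c hc, mul_zero, sub_zero] at h1
  exact (mul_eq_zero.1 h1).resolve_left (by positivity)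

theorem RadiallyNull.add {U : Set E} {f g : E → ℝ} (hf : Continuous f) (hg : Continuous g)
    (h : RadiallyNull U f) (h' : RadiallyNull U g) : RadiallyNull U fun y => f y + g y := by
  intro c hc ρ k
  have h1 := integral_add (integrable_radialPow_smul ρ k c hf) (integrable_radialPow_smul ρ k c hg)
  simp only [smul_eq_mul, h c hc, h' c hc, add_zero] at h1
  simpa only [mul_add] using h1

theorem RadiallyNull.const_mul {U : Set E} {f : E → ℝ} (h : RadiallyNull U f) (a : ℝ) :
    RadiallyNull U fun y => a * f y := by
  intro c hc ρ k
  simp_rw [mul_left_comm _ a]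
  rw [integral_const_mul, h c hc, mul_zero]

/-- The continuous functions that preserve `RadiallyNull U` as multipliers. -/
def nullMultipliers (U : Set E) : Subalgebra ℝ C(E, ℝ) where
  carrier := {P | ∀ f : E → ℝ, Continuous f → RadiallyNull U f → RadiallyNull U fun y => P y * f y}
  mul_mem' {P Q} hP hQ f hf h := by
    simpa [mul_assoc] using hP _ (Q.continuous.mul hf) (hQ f hf h)
  add_mem' {P Q} hP hQ f hf h := by
    simpa [add_mul] using (hP f hf h).add (P.continuous.mul hf) (Q.continuous.mul hf) (hQ f hf h)
  algebraMap_mem' a f _ h := by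
    simpa using h.const_mul a

theorem nullMultipliers_separatesPoints {U : Set E} (hU : IsOpen U) :
    (nullMultipliers U).SeparatesPoints := by
  intro x y hxy
  refine ⟨_, ⟨⟨fun z => inner ℝ (x - y) z, by fun_prop⟩, ?_, rfl⟩, ?_⟩
  · exact fun f hf h => h.inner_mul hU hf (x - y)
  · intro h
    have h' : inner ℝ (x - y) (x - y) = 0 := by
      rw [inner_sub_right]
      exact sub_eq_zero.2 h
    exact hxy (sub_eq_zero.1 (inner_self_eq_zero.1 h'))

/-- Stone–Weierstrass on a ball containing the support of the weight gives a multiplier P within ε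
of f. Since P f has zero moment, the weighted integral of f² is at most ε times that of |f|, hence
zero. -/
theorem RadiallyNull.eq_zero {U : Set E} (hU : IsOpen U) (hne : U.Nonempty) {f : E → ℝ}
    (hf : Continuous f) (h : RadiallyNull U f) : f = 0 := by
  obtain ⟨c, hc⟩ := hne
  funext x
  -- The added 1 makes the weight positive at x.
  set ρ := ‖x - c‖ ^ 2 + 1 with hρ
  have hi (g : E → ℝ) (hg : Continuous g) : Integrable fun y => radialPow ρ 1 (y - c) * g y :=
    integrable_radialPow_smul ρ 0 c hg
  set C := ∫ y, radialPow ρ 1 (y - c) * |f y| with hC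
  have hC0 : 0 ≤ C := integral_nonneg fun y => mul_nonneg (radialPow_nonneg _ _ _) (abs_nonneg _)
  have hle (ε : ℝ) (hε : 0 < ε) : ∫ y, radialPow ρ 1 (y - c) * (f y * f y) ≤ ε * C := by
    obtain ⟨P, hP, hPf⟩ :=
      ContinuousMap.exists_mem_subalgebra_near_continuous_of_isCompact_of_separatesPoints
        (nullMultipliers_separatesPoints hU) ⟨f, hf⟩
        (isCompact_closedBall c (Real.sqrt ρ)) hε
    have hz : ∫ y, radialPow ρ 1 (y - c) * (P y * f y) = 0 := hP f hf h c hc ρ 0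
    have i1 := hi (fun y => f y * f y) (hf.mul hf)
    have i2 := hi (fun y => P y * f y) (P.continuous.mul hf)
    rw [← sub_zero (∫ y, _), ← hz, ← integral_sub i1 i2, ← integral_const_mul]
    refine integral_mono (i1.sub i2)
      ((hi _ hf.abs).const_mul ε) fun y => ?_
    rcases le_or_gt ρ (‖y - c‖ ^ 2) with hy | hy
    · simp [radialPow_eq_zero (k := 0) hy]
    · have h1 := hPf y (by
        rw [Metric.mem_closedBall, dist_eq_norm]
        exact Real.le_sqrt_of_sq_le hy.le)
      have h2 : (f y - P y) * f y ≤ ε * |f y| := by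
        refine (le_abs_self _).trans ?_
        rw [abs_mul]
        refine mul_le_mul_of_nonneg_right ?_ (abs_nonneg _)
        rw [abs_sub_comm]
        exact h1.le
      have := mul_le_mul_of_nonneg_left h2 (radialPow_nonneg ρ 1 (y - c))
      simp only
      linarith
  have hcont : Continuous fun y => radialPow ρ 1 (y - c) * (f y * f y) :=
    ((continuous_radialPow ρ 1).comp (continuous_id.sub continuous_const)).mul (hf.mul hf)
  have hnn (y : E) : 0 ≤ radialPow ρ 1 (y - c) * (f y * f y) :=
    mul_nonneg (radialPow_nonneg _ _ _) (mul_self_nonneg _)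
  have hint : ∫ y, radialPow ρ 1 (y - c) * (f y * f y) = 0 := by
    refine le_antisymm (le_of_forall_pos_le_add fun ε hε => ?_) (integral_nonneg hnn)
    -- Dividing by C + 1 covers the case C = 0.
    refine (hle (ε / (C + 1)) (by positivity)).trans ?_
    rw [zero_add, div_mul_eq_mul_div, div_le_iff₀ (by positivity)]
    nlinarith
  have hae := (integral_eq_zero_iff_of_nonneg hnn (hi _ (hf.mul hf))).1 hint
  have hx := congrFun ((hcont.ae_eq_iff_eq volume continuous_zero).1 hae) x
  have hp : 0 < radialPow ρ 1 (x - c) := radialPow_pos (by rw [hρ]; linarith)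
  simpa [hp.ne'] using hx

/-- Unique continuation: a `C¹` solution of the Dirac-type equation `∑ A(bᵢ) ∂ᵢ u = 0` on the whole
space that vanishes on a nonempty open set is identically zero. -/
theorem eq_zero_of_dirac {ι : Type*} [Fintype ι] (b : OrthonormalBasis ι ℝ E)
    [FiniteDimensional ℝ V] (A A' : E →ₗ[ℝ] V →L[ℝ] V) (hA : ∀ v x, A' v (A v x) = ‖v‖ ^ 2 • x)
    {u : E → V} (hu : ContDiff ℝ 1 u) (hAu : ∀ y, ∑ i, A (b i) (fderiv ℝ u y (b i)) = 0)
    {U : Set E} (hU : IsOpen U) (hne : U.Nonempty) (h0 : ∀ y ∈ U, u y = 0) : u = 0 := by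
  funext x
  refine SeparatingDual.eq_zero_of_forall_dual_eq_zero (R := ℝ) fun l => ?_
  have hl : RadiallyNull U fun y => l (u y) := by
    intro c hc ρ k
    have h := radial_moment_eq_zero b A A' hA hu hAu
      (Filter.eventually_of_mem (hU.mem_nhds hc) h0) ρ k
    have h' := l.integral_comp_comm (integrable_radialPow_smul ρ k c hu.continuous)
    rw [h, map_zero] at h'
    simpa using h'
  exact congrFun (hl.eq_zero hU hne (l.continuous.comp hu.continuous)) x

end UniqueContinuation

section SliceUniqueness

/-! ### Uniqueness on a slice -/

open Filter Topology Set

theorem idx_injective (p : Fin 7) : Function.Injective (idx p) :=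
  Fin.castLE_injective (by omega)

theorem orthonormal_e_idx (p : Fin 7) : Orthonormal ℝ fun i => e (idx p i) := by
  have h : Orthonormal ℝ e := by
    rw [show e = EuclideanSpace.basisFun (Fin 8) ℝ from funext fun i => by simp [e]]
    exact (EuclideanSpace.basisFun (Fin 8) ℝ).orthonormal
  exact h.comp _ (idx_injective p)

/-- The map `slice p ω` as a linear map. -/
def sliceLin (p : Fin 7) (ω : Octonion) : Base p × ℝ →ₗ[ℝ] Octonion where
  toFun := slice p ω
  map_add' x y := by
    simp only [slice, emb, Prod.fst_add, Prod.snd_add, PiLp.add_apply, add_smul,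
      Finset.sum_add_distrib]
    abel
  map_smul' a x := by
    simp only [slice, emb, Prod.smul_fst, Prod.smul_snd, PiLp.smul_apply, smul_eq_mul, mul_smul,
      Finset.smul_sum, smul_add, RingHom.id_apply]

@[simp] theorem sliceLin_apply (p : Fin 7) (ω : Octonion) (y : Base p × ℝ) :
    sliceLin p ω y = slice p ω y := rfl

theorem emb_single (p : Fin 7) (i : Fin ((p : ℕ) + 1)) :
    emb p (EuclideanSpace.single i 1) = e (idx p i) := by
  simp [emb, ite_smul]

theorem inner_e_idx_sphere (p : Fin 7) {ω : Octonion} (hω : ω ∈ sphere p)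
    (i : Fin ((p : ℕ) + 1)) : inner ℝ (e (idx p i)) ω = 0 := by
  have h : ω (idx p i) = 0 := hω.1 _ (by simp [idx]; omega)
  simp [e, EuclideanSpace.inner_single_left, h]

theorem norm_slice_sq (p : Fin 7) {ω : Octonion} (hω : ω ∈ sphere p) (y : Base p × ℝ) :
    ‖slice p ω y‖ ^ 2 = ‖y.1‖ ^ 2 + y.2 ^ 2 := by
  have h1 : inner ℝ (emb p y.1) (y.2 • ω) = 0 := by
    simp [emb, sum_inner, inner_smul_left, inner_smul_right, inner_e_idx_sphere p hω]
  have h2 : ‖emb p y.1‖ ^ 2 = ‖y.1‖ ^ 2 := by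
    rw [← real_inner_self_eq_norm_sq, emb, (orthonormal_e_idx p).inner_sum,
      EuclideanSpace.norm_sq_eq]
    exact Finset.sum_congr rfl fun i _ => by simp [sq]
  rw [slice, norm_add_sq_real, h1, h2, norm_smul, hω.2]
  simp

/-- The operator `D_ω` is the Dirac-type operator with symbol `slice p ω`. -/
theorem sliceD_eq (p : Fin 7) (ω : Octonion) (F : Base p × ℝ → Octonion) (y : Base p × ℝ) :
    sliceD p ω F y = (∑ i, slice p ω (EuclideanSpace.single i 1, 0) *
      fderiv ℝ F y (EuclideanSpace.single i 1, 0)) + slice p ω (0, 1) * fderiv ℝ F y (0, 1) := by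
  have h : emb p 0 = 0 := by simp [emb]
  simp [sliceD, slice, emb_single, h]

/-- Unique continuation applies with A(v) left multiplication by the octonion `slice p ω v` and
A'(v) that by its conjugate: A'(v)A(v) = ‖v‖² because `slice p ω` preserves the Euclidean norm. -/
theorem slice_eq_zero_of_vanishing (p : Fin 7) {ω : Octonion} (hω : ω ∈ sphere p)
    {F : Base p × ℝ → Octonion} (hF : ContDiff ℝ 1 F) (hD : ∀ y, sliceD p ω F y = 0)
    (h0 : ∀ y : Base p × ℝ, y.2 < 0 → F y = 0) : F = 0 := by
  -- The product type carries the sup norm; the argument needs the Euclidean structure of `WithLp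
  -- 2`.
  let L := WithLp.prodContinuousLinearEquiv 2 ℝ (Base p) ℝ
  let b := (EuclideanSpace.basisFun (Fin ((p : ℕ) + 1)) ℝ).prod
    (OrthonormalBasis.singleton (Fin 1) ℝ)
  let B : WithLp 2 (Base p × ℝ) →ₗ[ℝ] Octonion := sliceLin p ω ∘ₗ (L : _ →ₗ[ℝ] Base p × ℝ)
  let _ : MeasurableSpace (WithLp 2 (Base p × ℝ)) := borel _
  have : BorelSpace (WithLp 2 (Base p × ℝ)) := ⟨rfl⟩
  have hfd (y v : WithLp 2 (Base p × ℝ)) : fderiv ℝ (F ∘ L) y v = fderiv ℝ F (L y) (L v) := by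
    rw [L.comp_right_fderiv]; rfl
  have hu : F ∘ L = 0 := by
    refine eq_zero_of_dirac b (mulL ∘ₗ B) (mulL ∘ₗ conj ∘ₗ B) (fun v x => ?_)
      (hF.comp L.contDiff) (fun y => ?_) (U := {y | (L y).2 < 0})
      (isOpen_lt (by fun_prop) continuous_const) ⟨L.symm (0, -1), by simp⟩ fun y hy => h0 _ hy
    · have hn : ‖B v‖ ^ 2 = ‖v‖ ^ 2 := by
        rw [WithLp.prod_norm_sq_eq_of_L2]
        simpa [B] using! norm_slice_sq p hω (L v)
      rw [← hn]
      exact conj_mul_mul_self _ _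
    · rw [← hD (L y), sliceD_eq, Fintype.sum_sum_type]
      simp only [hfd]
      congr 1
      · refine Finset.sum_congr rfl fun i _ => ?_
        have : L (b (Sum.inl i)) = (EuclideanSpace.single i 1, 0) := by
          simp [b, L]
        simp [B, this]
      · have : L (b (Sum.inr 0)) = (0, 1) := by
          simp [b, L]
        simp [B, this]
  funext y
  simpa using congrFun hu (L.symm y)

theorem mul_left_eq_zero_of_norm (ω : Octonion) (hω : ‖ω‖ = 1) {x : Octonion} (h : ω * x = 0) :
    x = 0 := by
  have := conj_mul_mul_self ω x
  rw [h, mul_zero_oct, hω] at this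
  simpa using this.symm

/-- A `C¹` solution of `D_ω F = 0` with `F(·, 0) = 0` vanishes for `r ≥ 0`. -/
theorem slice_eq_zero_of_initial (p : Fin 7) {ω : Octonion} (hω : ω ∈ sphere p)
    {F : Base p × ℝ → Octonion} (hF : ContDiff ℝ 1 F) (hD : ∀ y, sliceD p ω F y = 0)
    (h0 : ∀ x, F (x, 0) = 0) (x : Base p) {r : ℝ} (hr : 0 ≤ r) : F (x, r) = 0 := by
  have hdiff := hF.differentiable one_ne_zero
  have hbase (x v : Base p) : fderiv ℝ F (x, 0) (v, 0) = 0 := by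
    have h1 := HasFDerivAt.comp (f := fun x : Base p => (x, (0 : ℝ))) x
      (hdiff (x, 0)).hasFDerivAt (hasFDerivAt_prodMk_left x (0 : ℝ))
    have h2 : F ∘ (fun x => (x, (0 : ℝ))) = fun _ => 0 := funext h0
    rw [h2] at h1
    simpa using (congrArg (fun L => L v) (h1.unique (hasFDerivAt_const _ x)))
  -- The tangential derivatives vanish at r = 0, so the equation reduces to ω ∂_r F = 0, and ω can
  -- be cancelled.
  have hfd (x : Base p) : fderiv ℝ F (x, 0) = 0 := by
    have h1 := hD (x, 0)
    simp only [sliceD, hbase, mul_zero_oct, Finset.sum_const_zero, zero_add] at h1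
    have h2 := mul_left_eq_zero_of_norm ω hω.2 h1
    refine ContinuousLinearMap.ext fun ⟨v, t⟩ => ?_
    have : (v, t) = (v, (0 : ℝ)) + t • ((0 : Base p), (1 : ℝ)) := by simp
    rw [this, map_add, map_smul, hbase, h2]
    simp
  let G : Base p × ℝ → Octonion := fun y => if 0 ≤ y.2 then F y else 0
  let G' : Base p × ℝ → Base p × ℝ →L[ℝ] Octonion := fun y => if 0 ≤ y.2 then fderiv ℝ F y else 0
  have hG (y : Base p × ℝ) : HasFDerivAt G (G' y) y := by
    rcases lt_trichotomy y.2 0 with h | h | h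
    · have he : G =ᶠ[𝓝 y] fun _ => 0 := by
        filter_upwards [continuous_snd.continuousAt.eventually (gt_mem_nhds h)] with z hz
        simp [G, not_le.2 hz]
      simpa [G', not_le.2 h] using (hasFDerivAt_const (0 : Octonion) y).congr_of_eventuallyEq he
    · obtain ⟨x, s⟩ := y
      obtain rfl : s = 0 := h
      have h1 := (hdiff (x, 0)).hasFDerivAt
      have hG' : G' (x, 0) = 0 := by simp [G', hfd]
      rw [hfd, hasFDerivAt_iff_isLittleO, h0] at h1
      rw [hG', hasFDerivAt_iff_isLittleO, show G (x, 0) = 0 by simp [G, h0]]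
      simp only [_root_.zero_apply, sub_zero] at h1 ⊢
      -- On the interface ‖G‖ ≤ ‖F‖, and F is little-o of the increment there.
      refine (Asymptotics.isBigO_of_le _ fun z => ?_).trans_isLittleO h1
      by_cases hz : 0 ≤ z.2 <;> simp [G, hz]
    · have he : G =ᶠ[𝓝 y] F := by
        filter_upwards [continuous_snd.continuousAt.eventually (lt_mem_nhds h)] with z hz
        have hz' : (0 : ℝ) < z.2 := hz
        simp [G, hz'.le]
      simpa [G', h.le] using (hdiff y).hasFDerivAt.congr_of_eventuallyEq he
  have hGc : ContDiff ℝ 1 G := by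
    rw [contDiff_one_iff_fderiv]
    refine ⟨fun y => (hG y).differentiableAt, ?_⟩
    rw [show fderiv ℝ G = G' from funext fun y => (hG y).fderiv]
    refine Continuous.if_le (hF.continuous_fderiv one_ne_zero) continuous_const continuous_const
      continuous_snd ?_
    rintro ⟨x, s⟩ hs
    obtain rfl : 0 = s := hs
    exact hfd x
  have hGD (y : Base p × ℝ) : sliceD p ω G y = 0 := by
    rw [sliceD, (hG y).fderiv]
    by_cases h : 0 ≤ y.2
    · simpa [G', h, sliceD] using hD y
    · simp [G', h, mul_zero_oct]
  have := congrFun (slice_eq_zero_of_vanishing p hω hGc hGD fun y hy => by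
    simp [G, not_le.2 hy]) (x, r)
  simpa [G, hr] using this

end SliceUniqueness

section Extension

/-! ### Constant-coefficient first-order operators and the Laplacian -/

open Filter Topology Set

/-- The operator `∑ sᵢ ∂ᵢ` with octonionic coefficients acting from the left. -/
def symbolD (p : Fin 7) (s : Fin ((p : ℕ) + 1) → Octonion) (f : Base p → Octonion) (x : Base p) :
    Octonion :=
  ∑ i, s i * fderiv ℝ f x (EuclideanSpace.single i 1)

theorem baseD_eq_symbolD (p : Fin 7) (f : Base p → Octonion) :
    baseD p f = symbolD p (fun i => e (idx p i)) f := rfl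

theorem symbolD_neg (p : Fin 7) (s : Fin ((p : ℕ) + 1) → Octonion) (f : Base p → Octonion) :
    symbolD p s (-f) = -symbolD p s f := by
  funext x
  simp [symbolD, fderiv_neg, mul_neg_oct]

theorem hasFDerivAt_symbolD (p : Fin 7) (s : Fin ((p : ℕ) + 1) → Octonion)
    {f : Base p → Octonion} (hf : ContDiff ℝ 2 f) (x : Base p) :
    HasFDerivAt (symbolD p s f) (∑ j, (mulL (s j)).comp
      ((fderiv ℝ (fderiv ℝ f) x).flip (EuclideanSpace.single j 1))) x := by
  have h : HasFDerivAt (fderiv ℝ f) (fderiv ℝ (fderiv ℝ f) x) x :=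
    ((hf.fderiv_right (m := 1) (by norm_num)).differentiable one_ne_zero x).hasFDerivAt
  refine HasFDerivAt.fun_sum fun j _ => ?_
  have h1 := h.clm_apply (hasFDerivAt_const (EuclideanSpace.single j (1 : ℝ)) x)
  simp only [ContinuousLinearMap.comp_zero, zero_add] at h1
  exact (mulL (s j)).hasFDerivAt.comp x h1

theorem inner_conj_conj (a b : Octonion) : inner ℝ (conj a) (conj b) = inner ℝ a b :=
  LinearIsometry.inner_map_map ⟨conj, norm_conj⟩ a b

/-- The conjugate of a first-order operator with orthonormal coefficients factors the Laplacian. -/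
theorem symbolD_conj_symbolD (p : Fin 7) {s : Fin ((p : ℕ) + 1) → Octonion}
    (hs : Orthonormal ℝ s) {f : Base p → Octonion} (hf : ContDiff ℝ 2 f) :
    symbolD p (fun i => conj (s i)) (symbolD p s f) = Laplacian.laplacian f := by
  funext x
  set H := fderiv ℝ (fderiv ℝ f) x with hH
  have hsymm (v w : Base p) : H v w = H w v :=
    (hf.contDiffAt.isSymmSndFDerivAt (by simp)).eq v w
  set b : Fin ((p : ℕ) + 1) → Base p := fun i => EuclideanSpace.single i 1 with hb
  have h1 : symbolD p (fun i => conj (s i)) (symbolD p s f) x =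
      ∑ i, ∑ j, conj (s i) * (s j * H (b i) (b j)) := by
    refine Finset.sum_congr rfl fun i _ => ?_
    rw [(hasFDerivAt_symbolD p s hf x).fderiv, ← mulL_apply]
    simp [hH, hb]
  -- Symmetry of the second derivative allows averaging over the exchange of i and j; the polarised
  -- identity and orthonormality then leave only the diagonal.
  have h2 : symbolD p (fun i => conj (s i)) (symbolD p s f) x =
      ∑ i, ∑ j, conj (s j) * (s i * H (b i) (b j)) := by
    rw [h1, Finset.sum_comm]
    exact Finset.sum_congr rfl fun i _ => Finset.sum_congr rfl fun j _ => by rw [hsymm]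
  have h3 : Laplacian.laplacian f x = ∑ i, H (b i) (b i) := by
    rw [InnerProductSpace.laplacian_eq_iteratedFDeriv_orthonormalBasis f
      (EuclideanSpace.basisFun _ ℝ)]
    simp [iteratedFDeriv_two_apply, hH, hb]
  have h4 : (2 : ℝ) • symbolD p (fun i => conj (s i)) (symbolD p s f) x =
      (2 : ℝ) • Laplacian.laplacian f x := by
    rw [two_smul]
    nth_rewrite 1 [h1]
    rw [h2, h3]
    simp only [← Finset.sum_add_distrib, conj_mul_mul_add, orthonormal_iff_ite.1 hs]
    simp [Finset.smul_sum]
  exact smul_right_injective _ (two_ne_zero (α := ℝ)) h4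

theorem baseD_conj_baseD (p : Fin 7) {f : Base p → Octonion} (hf : ContDiff ℝ 2 f) :
    symbolD p (fun i => conj (e (idx p i))) (baseD p f) = Laplacian.laplacian f :=
  symbolD_conj_symbolD p (orthonormal_e_idx p) hf

/-- Conjugation is an isometric involution, so the conjugate coefficients are again orthonormal and
the two factors may be exchanged. -/
theorem baseD_symbolD_conj (p : Fin 7) {f : Base p → Octonion} (hf : ContDiff ℝ 2 f) :
    baseD p (symbolD p (fun i => conj (e (idx p i))) f) = Laplacian.laplacian f := by
  have hs : Orthonormal ℝ fun i => conj (e (idx p i)) := by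
    rw [orthonormal_iff_ite]
    intro i j
    rw [inner_conj_conj, orthonormal_iff_ite.1 (orthonormal_e_idx p)]
  simpa only [conj_conj, ← baseD_eq_symbolD] using symbolD_conj_symbolD p hs hf

/-! ### Polynomial maps of bounded degree -/

open MvPolynomial in
theorem hasFDerivAt_eval {n : ℕ} (P : MvPolynomial (Fin n) ℝ) (x : EuclideanSpace ℝ (Fin n)) :
    HasFDerivAt (fun x : EuclideanSpace ℝ (Fin n) => eval (fun i => x i) P)
      (∑ i, eval (fun i => x i) (pderiv i P) • EuclideanSpace.proj (𝕜 := ℝ) i) x := by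
  induction P using MvPolynomial.induction_on with
  | C a => simpa using hasFDerivAt_const a x
  | add P Q hP hQ =>
    simpa only [map_add, add_smul, Finset.sum_add_distrib] using hP.fun_add hQ
  | mul_X P i hP =>
    have h := hP.fun_mul (EuclideanSpace.proj (𝕜 := ℝ) i).hasFDerivAt
    simp only [map_mul, eval_X]
    convert! h using 1
    ext v
    simp [pderiv_X, Pi.single_apply, add_mul, Finset.sum_add_distrib, Finset.mul_sum, apply_ite]
    refine Finset.sum_congr rfl fun j _ => by ring

open MvPolynomial in
theorem contDiff_eval {n : ℕ} (P : MvPolynomial (Fin n) ℝ) {m : WithTop ℕ∞} :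
    ContDiff ℝ m fun x : EuclideanSpace ℝ (Fin n) => eval (fun i => x i) P := by
  induction P using MvPolynomial.induction_on with
  | C a => simpa using contDiff_const
  | add P Q hP hQ => simpa only [map_add] using hP.add hQ
  | mul_X P i hP =>
    simp only [map_mul, eval_X]
    exact hP.mul (EuclideanSpace.proj (𝕜 := ℝ) i).contDiff

/-- `f` is a polynomial map all of whose monomials have degree less than `n`. -/
def IsPolyLT (p : Fin 7) (n : ℕ) (f : Base p → Octonion) : Prop :=
  ∃ P : Fin 8 → MvPolynomial (Fin ((p : ℕ) + 1)) ℝ,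
    (∀ j d, n ≤ d.degree → (P j).coeff d = 0) ∧
    ∀ x j, f x j = MvPolynomial.eval (fun i => x i) (P j)

namespace IsPolyLT

variable {p : Fin 7} {n : ℕ} {f : Base p → Octonion}

theorem mono {m : ℕ} (h : IsPolyLT p n f) (hnm : n ≤ m) : IsPolyLT p m f :=
  let ⟨P, hP, hf⟩ := h
  ⟨P, fun j d hd => hP j d (hnm.trans hd), hf⟩

/-- The strict degree bound makes 0 the terminal case; this is what makes the series finite. -/
theorem eq_zero (h : IsPolyLT p 0 f) : f = 0 := by
  obtain ⟨P, hP, hf⟩ := h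
  funext x
  ext j
  have : P j = 0 := MvPolynomial.ext _ _ fun d => by simpa using hP j d (Nat.zero_le _)
  simp [hf, this]

theorem contDiff (h : IsPolyLT p n f) {m : WithTop ℕ∞} : ContDiff ℝ m f := by
  obtain ⟨P, -, hf⟩ := h
  rw [contDiff_euclidean]
  intro j
  simp only [hf]
  exact contDiff_eval _

theorem neg (h : IsPolyLT p n f) : IsPolyLT p n (-f) := by
  obtain ⟨P, hP, hf⟩ := h
  exact ⟨fun j => -P j, fun j d hd => by simp [hP j d hd], fun x j => by simp [hf]⟩

theorem sum {ι : Type*} (s : Finset ι) {g : ι → Base p → Octonion}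
    (h : ∀ i, IsPolyLT p n (g i)) : IsPolyLT p n fun x => ∑ i ∈ s, g i x := by
  choose P hP hg using h
  exact ⟨fun j => ∑ i ∈ s, P i j,
    fun j d hd => by simp [MvPolynomial.coeff_sum, fun i => hP i j d hd],
    fun x j => by simp [hg]⟩

theorem mul_left (h : IsPolyLT p n f) (a : Octonion) : IsPolyLT p n fun x => a * f x := by
  obtain ⟨P, hP, hf⟩ := h
  refine ⟨fun k => ∑ i, ∑ j, MvPolynomial.C ((octConst i j k : ℝ) * a i) * P j,
    fun k d hd => ?_, fun x k => ?_⟩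
  · simp only [MvPolynomial.coeff_sum, MvPolynomial.coeff_C_mul, fun j => hP j d hd, mul_zero,
      Finset.sum_const_zero]
  · simp [mul_apply, hf, mul_assoc]

theorem fderiv_single (h : IsPolyLT p (n + 1) f) (i : Fin ((p : ℕ) + 1)) :
    IsPolyLT p n fun x => fderiv ℝ f x (EuclideanSpace.single i 1) := by
  have hd := h.contDiff (m := 1)
  obtain ⟨P, hP, hf⟩ := h
  refine ⟨fun j => MvPolynomial.pderiv i (P j), fun j d hd => ?_, fun x j => ?_⟩
  · rw [MvPolynomial.coeff_pderiv, hP, zero_mul]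
    simpa [Finsupp.degree_single] using hd
  · have h1 := (EuclideanSpace.proj (𝕜 := ℝ) j).hasFDerivAt.comp x
      (hd.differentiable one_ne_zero x).hasFDerivAt
    have h2 := h1.unique (f := fun x => f x j) (by
      simp only [hf]
      exact hasFDerivAt_eval (P j) x)
    simpa [Pi.single_apply] using congrArg (fun L => L (EuclideanSpace.single i 1)) h2

theorem symbolD (h : IsPolyLT p (n + 1) f) (s : Fin ((p : ℕ) + 1) → Octonion) :
    IsPolyLT p n (symbolD p s f) :=
  sum _ fun i => (h.fderiv_single i).mul_left (s i)

/-- The Laplacian lowers the degree by two; recording a drop of one suffices, hence the weakening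
between the two first-order factors. -/
theorem neg_laplacian (h : IsPolyLT p (n + 1) f) : IsPolyLT p n (-(Laplacian.laplacian f)) := by
  rw [← baseD_conj_baseD p h.contDiff]
  exact (((h.symbolD _).mono n.le_succ).symbolD _).neg

theorem negLaplacianPow {m : ℕ} (h : IsPolyLT p (n + m) f) :
    IsPolyLT p n (negLaplacianPow p m f) := by
  induction m generalizing f with
  | zero => exact h
  | succ m ih => exact ih (f := -(Laplacian.laplacian f)) h.neg_laplacian

/-- DΔ = D(D̄D) = (DD̄)D = ΔD. -/
theorem baseD_neg_laplacian (h : IsPolyLT p n f) :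
    baseD p (-(Laplacian.laplacian f)) = -(Laplacian.laplacian (baseD p f)) := by
  rw [← baseD_conj_baseD p h.contDiff, baseD_eq_symbolD, symbolD_neg, ← baseD_eq_symbolD,
    baseD_symbolD_conj p (f := baseD p f) ((h.mono n.le_succ).symbolD _).contDiff]

theorem baseD_negLaplacianPow (h : IsPolyLT p n f) (k : ℕ) :
    baseD p (OctonionCK.negLaplacianPow p k f) = OctonionCK.negLaplacianPow p k (baseD p f) := by
  induction k generalizing f with
  | zero => rfl
  | succ k ih =>
    refine (ih (f := -(Laplacian.laplacian f)) (h.mono n.le_succ).neg_laplacian).trans ?_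
    rw [h.baseD_neg_laplacian]
    rfl

end IsPolyLT

theorem IsPolynomialMap.exists_isPolyLT {p : Fin 7} {f : Base p → Octonion}
    (h : IsPolynomialMap p f) : ∃ n, IsPolyLT p n f := by
  choose P hP using h
  refine ⟨∑ j, (P j).totalDegree + 1, P, fun j d hd => ?_, fun x j => hP j x⟩
  refine MvPolynomial.coeff_eq_zero_of_totalDegree_lt ?_
  have := Finset.single_le_sum (f := fun j => (P j).totalDegree) (fun _ _ => Nat.zero_le _)
    (Finset.mem_univ j)
  have hd' : d.degree = ∑ i ∈ d.support, d i := rfl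
  omega

/-! ### The extension solves the slice equation -/

theorem hasDerivAt_pow_div_factorial (n : ℕ) (r : ℝ) :
    HasDerivAt (fun r : ℝ => r ^ (n + 1) / ((n + 1).factorial : ℝ)) (r ^ n / (n.factorial : ℝ)) r := by
  refine ((hasDerivAt_pow (n + 1) r).div_const _).congr_deriv ?_
  rw [Nat.factorial_succ]
  push_cast
  have h1 : (n.factorial : ℝ) ≠ 0 := by positivity
  have h2 : (n + 1 : ℝ) ≠ 0 := by positivity
  field_simp

/-- In the odd sum the two signs cancel. Since x + rω = x + (-r)(-ω), the series formula thereby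
extends to r < 0 on each slice. -/
theorem ckSeries_neg (p : Fin 7) (f : Base p → Octonion) (x : Base p) (r : ℝ) (ω : Octonion) :
    ckSeries p f x (-r) (-ω) = ckSeries p f x r ω := by
  have h1 (k : ℕ) : (-r) ^ (2 * k) = r ^ (2 * k) := (even_two_mul k).neg_pow r
  have h2 (k : ℕ) : (-r) ^ (2 * k + 1) = -r ^ (2 * k + 1) := (odd_two_mul_add_one k).neg_pow r
  simp only [ckSeries, h1, h2, neg_div, neg_smul, tsum_neg, neg_mul_oct, mul_neg_oct, neg_neg]

theorem neg_mem_sphere {p : Fin 7} {ω : Octonion} (hω : ω ∈ sphere p) : -ω ∈ sphere p :=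
  ⟨fun i hi => by simp [hω.1 i hi], by rw [norm_neg, hω.2]⟩

theorem CK_comp_slice (p : Fin 7) (f : Base p → Octonion) {ω : Octonion} (hω : ω ∈ sphere p) :
    CK p f ∘ slice p ω = fun y => ckSeries p f y.1 y.2 ω := by
  funext ⟨x, r⟩
  rcases le_total 0 r with h | h
  · exact CK_slice p f hω x h
  · have hs : slice p ω (x, r) = slice p (-ω) (x, -r) := by simp [slice]
    rw [Function.comp_apply, hs, CK_slice p f (neg_mem_sphere hω) x (neg_nonneg.2 h), ckSeries_neg]

theorem conj_of_mem_sphere {p : Fin 7} {ω : Octonion} (hω : ω ∈ sphere p) : conj ω = -ω := by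
  ext i
  by_cases h : i = 0
  · subst h; simp [conj_apply, hω.1 0 (by simp)]
  · simp [conj_apply, h]

theorem mul_mul_of_mem_sphere {p : Fin 7} {ω : Octonion} (hω : ω ∈ sphere p) (x : Octonion) :
    ω * (ω * x) = -x := by
  have hc := conj_of_mem_sphere hω
  have h := conj_mul_mul_self ω x
  rw [hc, hω.2, neg_mul_oct] at h
  rw [← neg_neg (ω * _), h]
  simp

/-- The polarised identity for conj(e_i) and ω, which are orthogonal, with conj(ω) = -ω because ω
has no real part. It moves ω to the left of D at the price of turning D into D̄. -/
theorem e_mul_sphere_mul {p : Fin 7} {ω : Octonion} (hω : ω ∈ sphere p)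
    (i : Fin ((p : ℕ) + 1)) (x : Octonion) :
    e (idx p i) * (ω * x) = ω * (conj (e (idx p i)) * x) := by
  have hc := conj_of_mem_sphere hω
  have h := conj_mul_mul_add (conj (e (idx p i))) ω x
  have hi : inner ℝ (conj (e (idx p i))) ω = 0 := by
    rw [← neg_neg ω, ← hc, inner_neg_right, inner_conj_conj, inner_e_idx_sphere p hω, neg_zero]
  rw [conj_conj, hi, hc, neg_mul_oct, mul_zero, zero_smul] at h
  exact add_neg_eq_zero.1 h

/-- The effect of `D_ω` on a product of a function of `r` and a function of `x_p`. -/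
theorem sliceD_separated {p : Fin 7} {ω : Octonion} (hω : ω ∈ sphere p)
    {c d c' d' : ℝ → ℝ} {a b : Base p → Octonion} (hc : ∀ r, HasDerivAt c (c' r) r)
    (hd : ∀ r, HasDerivAt d (d' r) r) (ha : Differentiable ℝ a) (hb : Differentiable ℝ b)
    (y : Base p × ℝ) :
    sliceD p ω (fun y => c y.2 • a y.1 + ω * (d y.2 • b y.1)) y =
      c y.2 • baseD p a y.1 + ω * (c' y.2 • a y.1)
        + d y.2 • (ω * symbolD p (fun i => conj (e (idx p i))) b y.1) - d' y.2 • b y.1 := by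
  have hsep {c c' : ℝ → ℝ} {a : Base p → Octonion} (hc : ∀ r, HasDerivAt c (c' r) r)
      (ha : Differentiable ℝ a) : HasFDerivAt (fun y : Base p × ℝ => c y.2 • a y.1)
      (c y.2 • (fderiv ℝ a y.1).comp (ContinuousLinearMap.fst ℝ (Base p) ℝ) +
        (c' y.2 • ContinuousLinearMap.snd ℝ (Base p) ℝ).smulRight (a y.1)) y :=
    ((hc y.2).comp_hasFDerivAt y hasFDerivAt_snd).fun_smul
      ((ha y.1).hasFDerivAt.comp y hasFDerivAt_fst)
  have h := (hsep hc ha).fun_add ((mulL ω).hasFDerivAt.comp y (hsep hd hb))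
  have hF : fderiv ℝ (fun y : Base p × ℝ => c y.2 • a y.1 + ω * (d y.2 • b y.1)) y = _ := h.fderiv
  have hsm (t : ℝ) (u v : Octonion) : u * (t • v) = t • (u * v) := (mulL u).map_smul t v
  rw [sliceD, hF]
  simp [mul_add_oct, mul_zero_oct, hsm, e_mul_sphere_mul hω, mul_mul_of_mem_sphere hω,
    Finset.sum_add_distrib, baseD, symbolD]
  rw [← Finset.smul_sum, ← Finset.smul_sum]
  have hms (g : Fin ((p : ℕ) + 1) → Octonion) : ω * ∑ i, g i = ∑ i, ω * g i := map_sum (mulL ω) _ _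
  rw [hms]
  abel

theorem sliceD_sum {p : Fin 7} {ω : Octonion} {F : ℕ → Base p × ℝ → Octonion}
    (hF : ∀ k, Differentiable ℝ (F k)) (N : ℕ) (y : Base p × ℝ) :
    sliceD p ω (fun y => ∑ k ∈ Finset.range N, F k y) y =
      ∑ k ∈ Finset.range N, sliceD p ω (F k) y := by
  have hms (u : Octonion) (g : ℕ → Octonion) :
      u * ∑ i ∈ Finset.range N, g i = ∑ i ∈ Finset.range N, u * g i := map_sum (mulL u) _ _
  simp only [sliceD]
  rw [fderiv_fun_sum fun k _ => hF k y]
  simp only [_root_.sum_apply, hms, Finset.sum_add_distrib]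
  rw [Finset.sum_comm]

/-- Each Laplacian lowers the degree, so terms with k ≥ n vanish. Commuting D past (-Δ)^k gives the
summands the form required by `sliceD_separated`. -/
theorem ckSeries_eq_sum {p : Fin 7} {n : ℕ} {f : Base p → Octonion} (h : IsPolyLT p n f)
    (x : Base p) (r : ℝ) (ω : Octonion) :
    ckSeries p f x r ω = ∑ k ∈ Finset.range n,
      ((r ^ (2 * k) / ((2 * k).factorial : ℝ)) • negLaplacianPow p k f x +
        ω * ((r ^ (2 * k + 1) / ((2 * k + 1).factorial : ℝ)) •
          baseD p (negLaplacianPow p k f) x)) := by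
  have hz (k : ℕ) (hk : k ∉ Finset.range n) : negLaplacianPow p k f = 0 :=
    IsPolyLT.eq_zero (IsPolyLT.negLaplacianPow (h.mono (by simpa using hk)))
  have hD0 : baseD p 0 = 0 := by
    funext x
    simp [baseD, mul_zero_oct]
  rw [ckSeries, tsum_eq_sum (s := Finset.range n) fun k hk => by simp [hz k hk],
    tsum_eq_sum (s := Finset.range n) fun k hk => by
      rw [← h.baseD_negLaplacianPow, hz k hk, hD0]; simp,
    Finset.sum_add_distrib, ← mulL_apply, map_sum]
  simp only [h.baseD_negLaplacianPow, mulL_apply]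

/-- With a = (-Δ)^k f, the term r^{2k}/(2k)! Da cancels against the r-derivative of the odd part,
and D̄Da = Δa = -(-Δ)^{k+1} f links the k-th term to the next, so the sum telescopes. -/
theorem isGSM_CK {p : Fin 7} {f : Base p → Octonion} (hf : IsPolynomialMap p f) :
    IsGSM p Set.univ (CK p f) := by
  intro ω hω
  obtain ⟨n, h⟩ := hf.exists_isPolyLT
  have ha (k : ℕ) : IsPolyLT p n (negLaplacianPow p k f) :=
    IsPolyLT.negLaplacianPow (h.mono (Nat.le_add_right n k))
  have hb (k : ℕ) : IsPolyLT p n (baseD p (negLaplacianPow p k f)) :=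
    ((ha k).mono n.le_succ).symbolD _
  let F (k : ℕ) (y : Base p × ℝ) : Octonion :=
    (y.2 ^ (2 * k) / ((2 * k).factorial : ℝ)) • negLaplacianPow p k f y.1 +
      ω * ((y.2 ^ (2 * k + 1) / ((2 * k + 1).factorial : ℝ)) •
        baseD p (negLaplacianPow p k f) y.1)
  have hF (k : ℕ) : ContDiff ℝ 1 (F k) := by
    have h1 := (ha k).contDiff (m := 1)
    have h2 := (hb k).contDiff (m := 1)
    exact ContDiff.add (by fun_prop) ((mulL ω).contDiff.comp (by fun_prop))
  have hCK : CK p f ∘ slice p ω = fun y => ∑ k ∈ Finset.range n, F k y := by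
    rw [CK_comp_slice p f hω]
    exact funext fun y => ckSeries_eq_sum h _ _ _
  rw [hCK]
  refine ⟨(ContDiff.sum fun k _ => hF k).contDiffOn, fun y _ => ?_⟩
  rw [sliceD_sum fun k => (hF k).differentiable one_ne_zero]
  -- Writing the coefficient as a derivative makes it 0 at k = 0 without the exponent 2k - 1.
  let G (k : ℕ) : Octonion :=
    ω * (deriv (fun r : ℝ => r ^ (2 * k) / ((2 * k).factorial : ℝ)) y.2 • negLaplacianPow p k f y.1)
  have hG (k : ℕ) : sliceD p ω (F k) y = G k - G (k + 1) := by
    have hc (r : ℝ) : HasDerivAt (fun r : ℝ => r ^ (2 * k) / ((2 * k).factorial : ℝ))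
        (deriv (fun r : ℝ => r ^ (2 * k) / ((2 * k).factorial : ℝ)) r) r :=
      DifferentiableAt.hasDerivAt (by fun_prop)
    have hlap : symbolD p (fun i => conj (e (idx p i))) (baseD p (negLaplacianPow p k f)) =
        -negLaplacianPow p (k + 1) f := by
      rw [baseD_conj_baseD p (ha k).contDiff, negLaplacianPow, negLaplacianPow,
        Function.iterate_succ_apply', neg_neg]
    have hd := (hasDerivAt_pow_div_factorial (2 * k + 1) y.2).deriv
    have hsm (t : ℝ) (v : Octonion) : ω * (t • v) = t • (ω * v) := (mulL ω).map_smul t v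
    rw [sliceD_separated hω hc (hasDerivAt_pow_div_factorial (2 * k))
      ((ha k).contDiff.differentiable one_ne_zero) ((hb k).contDiff.differentiable one_ne_zero),
      hlap]
    simp only [G, Nat.mul_succ, hd, hsm, Pi.neg_apply, mul_neg_oct, smul_neg]
    abel
  simp_rw [hG]
  rw [Finset.sum_range_sub', sub_eq_zero]
  have h0 : G 0 = 0 := by simp [G, mul_zero_oct]
  have hn : G n = 0 := by
    have : negLaplacianPow p n f = 0 :=
      IsPolyLT.eq_zero (IsPolyLT.negLaplacianPow (h.mono (by simp)))
    simp [G, this, mul_zero_oct]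
  rw [h0, hn]

/-! ### Restriction to ℝ^{p+1} and global uniqueness -/

theorem CK_emb (p : Fin 7) (f : Base p → Octonion) (x : Base p) : CK p f (emb p x) = f x := by
  have hb : basePart p (emb p x) = x := by
    ext i
    exact emb_apply p x i
  have hr : restPart p (emb p x) = 0 := by simp [restPart, hb]
  rw [CK, hb, hr, ckSeries, tsum_eq_single 0 fun k hk => by simp [hk]]
  simp [mul_zero_oct, negLaplacianPow]

/-- A point off ℝ^{p+1} lies on the slice of its normalised ℝ^q-component, at r equal to the norm of
that component. There r ≥ 0, so uniqueness on the slice applies to the difference. -/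
theorem eq_of_isGSM {p : Fin 7} {g g' : Octonion → Octonion} (hg : IsGSM p Set.univ g)
    (hg' : IsGSM p Set.univ g') (h : ∀ x : Base p, g (emb p x) = g' (emb p x)) : g = g' := by
  funext z
  have hz : z = emb p (basePart p z) + restPart p z := by simp [restPart]
  by_cases hr : restPart p z = 0
  · rw [hz, hr, add_zero, h]
  have hn : ‖restPart p z‖ ≠ 0 := norm_ne_zero_iff.2 hr
  set ω := ‖restPart p z‖⁻¹ • restPart p z with hωdef
  have hω : ω ∈ sphere p := by
    refine ⟨fun i hi => ?_, by rw [hωdef, norm_smul, norm_inv, norm_norm, inv_mul_cancel₀ hn]⟩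
    have hi' : i = idx p ⟨i, by omega⟩ := rfl
    have : restPart p z i = 0 := by
      rw [restPart, PiLp.sub_apply, hi', emb_apply]
      exact sub_self _
    simp [hωdef, this]
  have hzs : z = slice p ω (basePart p z, ‖restPart p z‖) := by
    conv_lhs => rw [hz]
    rw [slice, hωdef, smul_inv_smul₀ hn]
  obtain ⟨h1, h2⟩ := hg ω hω
  obtain ⟨h3, h4⟩ := hg' ω hω
  rw [Set.preimage_univ, contDiffOn_univ] at h1 h3
  have hs0 (x : Base p) : slice p ω (x, 0) = emb p x := by simp [slice]
  have hmul_sub (a x y : Octonion) : a * (x - y) = a * x - a * y := (mulL a).map_sub x y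
  have h0 := slice_eq_zero_of_initial p hω (h1.sub h3) (fun y => ?_) (fun x => ?_)
    (basePart p z) (norm_nonneg (restPart p z))
  · rw [hzs]
    exact sub_eq_zero.1 h0
  · have e1 := h2 y trivial
    have e2 := h4 y trivial
    rw [sliceD] at e1 e2 ⊢
    rw [fderiv_fun_sub (h1.differentiable one_ne_zero y) (h3.differentiable one_ne_zero y)]
    simp only [_root_.sub_apply, hmul_sub, Finset.sum_sub_distrib]
    rw [sub_add_sub_comm, e1, e2, sub_zero]
  · simp only [Function.comp_apply, hs0, h, sub_self]

end Extension

end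

end OctonionCK

theorem mainTheorem9 (p : Fin 7) (f₀ : OctonionCK.Base p → OctonionCK.Octonion)
    (hf₀ : OctonionCK.IsPolynomialMap p f₀) :
    OctonionCK.IsGSM p Set.univ (OctonionCK.CK p f₀) ∧
    (∀ x : OctonionCK.Base p, OctonionCK.CK p f₀ (OctonionCK.emb p x) = f₀ x) ∧
    (∀ g : OctonionCK.Octonion → OctonionCK.Octonion,
      OctonionCK.IsGSM p Set.univ g →
      (∀ x : OctonionCK.Base p, g (OctonionCK.emb p x) = f₀ x) →
      g = OctonionCK.CK p f₀) :=
  ⟨OctonionCK.isGSM_CK hf₀, OctonionCK.CK_emb p f₀, fun _ hg h =>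
    OctonionCK.eq_of_isGSM hg (OctonionCK.isGSM_CK hf₀) fun x =>
      (h x).trans (OctonionCK.CK_emb p f₀ x).symm⟩
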